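/- Let $\mathbb{F}$ be a field, $A$ a finite-dimensional $\mathbb{F}$-algebra, $\sigma$ an $\mathbb{F}$-algebra automorphism of $A$, and $\delta$ an $\mathbb{F}$-linear endomorphism of $A$ with $\delta(ab)=\sigma(a)\delta(b)+\delta(a)b$ for all $a,b\in A$, such that both $\delta$ and $\delta'=-\delta\sigma^{-1}$ are nilpotent. Let $A[X;\sigma,\delta]$ be the skew polynomial ring (left $A$-basis $\{X^i\}_{i\ge 0}$, with $Xa=\sigma(a)X+\delta(a)$), and let $A((X;\sigma,\delta))$ be the ring of left skew Laurent series $\sum_{i\ge i_0}s_iX^i$, $s_i \in A$, $i_0 \in \mathbb{Z}$, whose product is $(\sum_i s_iX^i)t=\sum_i s_i\,(X^it)$, where $Xt=\sigma(t)X+\delta(t)$ and $X^{-1}t=\sum_{k\ge 0}\sigma^{-1}\delta'^k(t)X^{-1-k}$ ($\sigma$, $\delta$, $\delta'$ acting coefficientwise); it contains $A[X;\sigma,\delta]$ as a subring. In the same way, for a finite-dimensional right $A$-module $M$, the Laurent series $M((X))$ form a right $A((X;\sigma,\delta))$-module, hence a right $A$-module. Let $\varphi:A\to\mathbb{F}^n$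 be any $\mathbb{F}$-linear isomorphism, give $\mathbb{F}^n$ the right $A$-module structure for which $\varphi$ is an isomorphism from the regular right module $A$, and identify $A((X;\sigma,\delta))$ with $\mathbb{F}^n((X))$ by applying $\varphi$ to the coefficients. A convolutional code is an $\mathbb{F}((X))$-subspace of $\mathbb{F}^n((X))$ that has a basis consisting of vectors in $\mathbb{F}^n[X]$; it is $(\sigma,\delta,A)$-cyclic if it is a right $A$-submodule of $\mathbb{F}^n((X))$. A right ideal code is a right ideal of $A[X;\sigma,\delta]$ that is a direct summand of $A[X]$ as an $\mathbb{F}[X]$-module (with the usual module structure $(\sum_i a_iX^i)(\sum_j c_jX^j)=\sum_{i,j}a_ic_jX^{i+j}$). Then the map $\mathcal{D}\mapsto\mathcal{D}\cap A[X;\sigma,\delta]$ is a bijection from the set of all $(\sigma,\delta,A)$-cyclic convolutional codes in $A((X;\sigma,\delta))$ onto the set of all right ideal codes. -/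

import Mathlib

open scoped LaurentSeries Polynomial
open MulOpposite

/-- A left skew derivation `(σ, δ)` of the `F`-algebra `A`, where `σ` is an `F`-algebra automorphism
and `δ` is `F`-linear, such that both `δ` and `δ' = -δ σ⁻¹` are nilpotent. -/
structure NilSkewDerivation (F A : Type*) [Field F] [Ring A] [Algebra F A] where
  σ : A ≃ₐ[F] A
  δ : Module.End F A
  leibniz : ∀ a b : A, δ (a * b) = σ a * δ b + δ a * b
  nilpotent : IsNilpotent δ
  nilpotent' : IsNilpotent (-(δ ∘ₗ σ.symm.toLinearMap) : Module.End F A)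

noncomputable section

namespace NilSkewDerivation

variable {F A M : Type*} [Field F] [Ring A] [Algebra F A] [AddCommGroup M] [Module Aᵐᵒᵖ M]

section Shift

variable (d : NilSkewDerivation F A)

/-- `δ' = -δ σ⁻¹`. -/
def δ' : Module.End F A := -(d.δ ∘ₗ d.σ.symm.toLinearMap)

/-- Left multiplication by `X`, coefficientwise: `X s = σ(s) X + δ(s)`. -/
def leftX (s : ℤ → A) : ℤ → A := fun n => d.σ (s (n - 1)) + d.δ (s n)

/-- Left multiplication by `X⁻¹`: `X⁻¹ s = ∑ₖ σ' δ'ᵏ(s) X^(-1-k)`, with `σ' = σ⁻¹`. -/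
def leftXInv (s : ℤ → A) : ℤ → A := fun n =>
  ∑ k ∈ Finset.range (nilpotencyClass d.δ'), d.σ.symm ((d.δ' ^ k) (s (n + 1 + k)))

theorem δ'_σ (a : A) : d.δ' (d.σ a) = -d.δ a := by simp [δ']

theorem δ_σ_symm (a : A) : d.δ (d.σ.symm a) = -d.δ' a := by simp [δ']

theorem σ_one_δ : d.δ 1 = 0 := by
  have h := d.leibniz 1 1
  simpa using h

theorem leftXInv_leftX (s : ℤ → A) : d.leftXInv (d.leftX s) = s := by
  funext n
  have h : ∀ k : ℕ, d.σ.symm ((d.δ' ^ k) (d.leftX s (n + 1 + k))) =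
      d.σ.symm ((d.δ' ^ k) (d.σ (s (n + k)))) -
      d.σ.symm ((d.δ' ^ (k + 1)) (d.σ (s (n + (k + 1 : ℕ))))) := by
    intro k
    have e1 : n + 1 + (k : ℤ) - 1 = n + k := by ring
    have e2 : n + 1 + (k : ℤ) = n + (k + 1 : ℕ) := by push_cast; ring
    rw [leftX, e1, e2, map_add, map_add, pow_succ, Module.End.mul_apply, δ'_σ]
    simp
  simp only [leftXInv]
  rw [Finset.sum_congr rfl (fun k _ => h k), Finset.sum_range_sub'
    (fun k : ℕ => d.σ.symm ((d.δ' ^ k) (d.σ (s (n + k)))))]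
  rw [pow_nilpotencyClass (x := d.δ') d.nilpotent']
  simp

theorem leftX_leftXInv (s : ℤ → A) : d.leftX (d.leftXInv s) = s := by
  funext n
  have h : ∀ k : ℕ, d.σ (d.σ.symm ((d.δ' ^ k) (s (n - 1 + 1 + k)))) +
      d.δ (d.σ.symm ((d.δ' ^ k) (s (n + 1 + k)))) =
      (d.δ' ^ k) (s (n + k)) - (d.δ' ^ (k + 1)) (s (n + (k + 1 : ℕ))) := by
    intro k
    have e1 : n - 1 + 1 + (k : ℤ) = n + k := by ring
    have e2 : n + 1 + (k : ℤ) = n + (k + 1 : ℕ) := by push_cast; ring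
    rw [e1, e2, δ_σ_symm, pow_succ', Module.End.mul_apply]
    simp [sub_eq_add_neg]
  simp only [leftX, leftXInv, map_sum]
  rw [← Finset.sum_add_distrib, Finset.sum_congr rfl (fun k _ => h k), Finset.sum_range_sub'
    (fun k : ℕ => (d.δ' ^ k) (s (n + k)))]
  rw [pow_nilpotencyClass (x := d.δ') d.nilpotent']
  simp

/-- Left multiplication by `X` as an automorphism of the space of all two-sided sequences; its integer powers are the left multiplications by `X ^ i`. -/
def shift : (ℤ → A) ≃ₗ[F] (ℤ → A) where
  toFun := d.leftX
  invFun := d.leftXInv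
  left_inv := d.leftXInv_leftX
  right_inv := d.leftX_leftXInv
  map_add' s t := by
    funext n
    simp only [leftX, Pi.add_apply, map_add]
    abel
  map_smul' c s := by
    funext n
    simp [leftX]

/-- `X ^ i t`, for an integer `i`. -/
def powX (i : ℤ) (t : ℤ → A) : ℤ → A := (d.shift ^ i) t

theorem powX_zero (t : ℤ → A) : d.powX 0 t = t := by simp [powX]

theorem powX_one_add (i : ℤ) (t : ℤ → A) : d.powX (1 + i) t = d.leftX (d.powX i t) := by
  rw [powX, zpow_one_add]; rfl

theorem powX_add_one (i : ℤ) (t : ℤ → A) : d.powX (i + 1) t = d.powX i (d.leftX t) := by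
  rw [powX, zpow_add_one]; rfl

theorem powX_add (i j : ℤ) (t : ℤ → A) : d.powX (i + j) t = d.powX i (d.powX j t) := by
  rw [powX, zpow_add]; rfl

theorem powX_map_add (i : ℤ) (s t : ℤ → A) : d.powX i (s + t) = d.powX i s + d.powX i t :=
  map_add (d.shift ^ i) s t

theorem powX_map_zero (i : ℤ) : d.powX i 0 = 0 := map_zero (d.shift ^ i)


theorem powX_map_smul (i : ℤ) (c : F) (t : ℤ → A) : d.powX i (c • t) = c • d.powX i t :=
  map_smul (d.shift ^ i) c t

end Shift

section Support

variable (d : NilSkewDerivation F A)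

/-- The sequence `s` has no terms of degree less than `j`. -/
def VanishBelow {N : Type*} [Zero N] (j : ℤ) (s : ℤ → N) : Prop := ∀ k < j, s k = 0

theorem VanishBelow.mono {N : Type*} [Zero N] {j j' : ℤ} {s : ℤ → N} (h : VanishBelow j s)
    (hj : j' ≤ j) : VanishBelow j' s := fun k hk => h k (by omega)

theorem VanishBelow.leftX {j : ℤ} {s : ℤ → A} (h : VanishBelow j s) :
    VanishBelow j (d.leftX s) := fun k hk => by
  simp [NilSkewDerivation.leftX, h k hk, h (k - 1) (by omega)]

theorem VanishBelow.leftXInv {j : ℤ} {s : ℤ → A} (h : VanishBelow j s) :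
    VanishBelow (j - nilpotencyClass d.δ') (d.leftXInv s) := fun k hk => by
  refine Finset.sum_eq_zero fun r hr => ?_
  have := Finset.mem_range.1 hr
  rw [h _ (by omega)]
  simp

theorem VanishBelow.powX_nat {j : ℤ} {s : ℤ → A} (h : VanishBelow j s) (r : ℕ) :
    VanishBelow j (d.powX r s) := by
  induction r with
  | zero => simpa [powX_zero] using h
  | succ r ih =>
    rw [Nat.cast_succ, add_comm, powX_one_add]
    exact ih.leftX d

theorem powX_nat_coeff {j : ℤ} {s : ℤ → A} (h : VanishBelow j s) (r : ℕ) :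
    d.powX r s j = (d.δ ^ r) (s j) := by
  induction r with
  | zero => simp [powX_zero]
  | succ r ih =>
    rw [Nat.cast_succ, add_comm, powX_one_add, NilSkewDerivation.leftX, ih,
      h.powX_nat d r (j - 1) (by omega), pow_succ', Module.End.mul_apply]
    simp

theorem VanishBelow.powX_class {j : ℤ} {s : ℤ → A} (h : VanishBelow j s) (q : ℕ) :
    VanishBelow (j + q) (d.powX (nilpotencyClass d.δ * q : ℕ) s) := by
  induction q with
  | zero => simpa [powX_zero] using h
  | succ q ih =>
    have e : ((nilpotencyClass d.δ * (q + 1) : ℕ) : ℤ) =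
        (nilpotencyClass d.δ : ℕ) + (nilpotencyClass d.δ * q : ℕ) := by push_cast; ring
    rw [e, powX_add]
    intro k hk
    rcases lt_or_eq_of_le (show k ≤ j + q by push_cast at hk; omega) with hk' | rfl
    · exact ih.powX_nat d _ k hk'
    · rw [powX_nat_coeff d ih, pow_nilpotencyClass d.nilpotent]
      simp

theorem VanishBelow.powX_neg {j : ℤ} {s : ℤ → A} (h : VanishBelow j s) (r : ℕ) :
    VanishBelow (j - nilpotencyClass d.δ' * r) (d.powX (-r) s) := by
  induction r with
  | zero => simpa [powX_zero] using h
  | succ r ih =>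
    have e : d.powX (-((r + 1 : ℕ) : ℤ)) s = d.leftXInv (d.powX (-(r : ℤ)) s) := by
      rw [← d.leftXInv_leftX (d.powX (-((r + 1 : ℕ) : ℤ)) s), ← powX_one_add]
      congr 2
      push_cast
      ring
    rw [e]
    refine (ih.leftXInv d).mono ?_
    push_cast
    linarith

theorem VanishBelow.exists_powX {j : ℤ} {t : ℤ → A} (h : VanishBelow j t) (i₀ : ℤ) :
    ∃ J : ℤ, ∀ q : ℕ, ∀ i ≥ i₀ + nilpotencyClass d.δ * q, VanishBelow (J + q) (d.powX i t) := by
  have hJ : ∃ J : ℤ, VanishBelow J (d.powX i₀ t) := by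
    obtain ⟨r, rfl | rfl⟩ := Int.eq_nat_or_neg i₀
    · exact ⟨_, h.powX_nat d r⟩
    · exact ⟨_, h.powX_neg d r⟩
  obtain ⟨J, hJ⟩ := hJ
  refine ⟨J, fun q i hi => ?_⟩
  obtain ⟨r, hr⟩ := Int.eq_ofNat_of_zero_le (sub_nonneg.2 hi)
  have e : i = r + ((nilpotencyClass d.δ * q : ℕ) + i₀) := by push_cast; linarith
  rw [e, powX_add, powX_add]
  exact (hJ.powX_class d q).powX_nat d r

theorem VanishBelow.exists_powX_eq_zero {j : ℤ} {t : ℤ → A} (h : VanishBelow j t) (n : ℤ) :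
    ∃ I : ℤ, ∀ i ≥ I, d.powX i t n = 0 := by
  obtain ⟨J, hJ⟩ := h.exists_powX d 0
  refine ⟨0 + nilpotencyClass d.δ * ((n + 1 - J).toNat : ℕ), fun i hi => ?_⟩
  exact hJ _ i hi n (by omega)

end Support

section Action

variable (d : NilSkewDerivation F A)

/-- The right action of series with coefficients in `A` on series with coefficients in the right
`A`-module `M`: the coefficient of degree `n` of `(∑ᵢ sᵢ Xⁱ) t` is `∑ᵢ sᵢ (Xⁱ t)ₙ`. The sum is
finite when `s` and `t` are Laurent series. -/
def act (s : ℤ → M) (t : ℤ → A) : ℤ → M := fun n => ∑ᶠ i : ℤ, op (d.powX i t n) • s i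

theorem act_eq_sum {i₀ I n : ℤ} {s : ℤ → M} {t : ℤ → A} (hs : VanishBelow i₀ s)
    (hI : ∀ i ≥ I, d.powX i t n = 0) :
    d.act s t n = ∑ i ∈ Finset.Ico i₀ I, op (d.powX i t n) • s i := by
  refine finsum_eq_sum_of_support_subset _ fun i hi => ?_
  rw [Finset.coe_Ico, Set.mem_Ico]
  by_contra hc
  rw [not_and_or, not_le, not_lt] at hc
  apply hi
  rcases hc with hc | hc
  · simp [hs i hc]
  · simp [hI i hc]

theorem VanishBelow.exists_act {i₀ j₀ : ℤ} {s : ℤ → M} {t : ℤ → A} (hs : VanishBelow i₀ s)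
    (ht : VanishBelow j₀ t) : ∃ J, VanishBelow J (d.act s t) := by
  obtain ⟨J, hJ⟩ := ht.exists_powX d i₀
  refine ⟨J, fun n hn => finsum_eq_zero_of_forall_eq_zero fun i => ?_⟩
  by_cases hi : i < i₀
  · simp [hs i hi]
  · rw [hJ 0 i (by push_cast; omega) n (by push_cast; omega)]
    simp

theorem act_add_left {i₀ i₁ j₀ : ℤ} {s s' : ℤ → M} {t : ℤ → A} (hs : VanishBelow i₀ s)
    (hs' : VanishBelow i₁ s') (ht : VanishBelow j₀ t) :
    d.act (s + s') t = d.act s t + d.act s' t := by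
  funext n
  obtain ⟨I, hI⟩ := ht.exists_powX_eq_zero d n
  have h1 := hs.mono (min_le_left i₀ i₁)
  have h2 := hs'.mono (min_le_right i₀ i₁)
  have h3 : VanishBelow (min i₀ i₁) (s + s') := fun k hk => by simp [h1 k hk, h2 k hk]
  rw [Pi.add_apply, act_eq_sum d h1 hI, act_eq_sum d h2 hI, act_eq_sum d h3 hI,
    ← Finset.sum_add_distrib]
  simp

theorem act_add_right {i₀ j₀ j₁ : ℤ} {s : ℤ → M} {t t' : ℤ → A} (hs : VanishBelow i₀ s)
    (ht : VanishBelow j₀ t) (ht' : VanishBelow j₁ t') :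
    d.act s (t + t') = d.act s t + d.act s t' := by
  funext n
  obtain ⟨I, hI⟩ := ht.exists_powX_eq_zero d n
  obtain ⟨I', hI'⟩ := ht'.exists_powX_eq_zero d n
  have h1 : ∀ i ≥ max I I', d.powX i t n = 0 := fun i hi => hI i (le_trans (le_max_left _ _) hi)
  have h2 : ∀ i ≥ max I I', d.powX i t' n = 0 := fun i hi => hI' i (le_trans (le_max_right _ _) hi)
  have h3 : ∀ i ≥ max I I', d.powX i (t + t') n = 0 := fun i hi => by
    rw [powX_map_add, Pi.add_apply, h1 i hi, h2 i hi, add_zero]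
  rw [Pi.add_apply, act_eq_sum d hs h1, act_eq_sum d hs h2, act_eq_sum d hs h3,
    ← Finset.sum_add_distrib]
  simp [powX_map_add, add_smul]

theorem zero_act (t : ℤ → A) : d.act (0 : ℤ → M) t = 0 := by
  funext n
  simp [act]

theorem act_zero (s : ℤ → M) : d.act s (0 : ℤ → A) = 0 := by
  funext n
  simp [act, powX_map_zero]

/-- The sequence of the monomial `a Xⁱ`. -/
def mono (i : ℤ) (m : M) : ℤ → M := Pi.single i m

theorem vanishBelow_mono (i : ℤ) (m : M) : VanishBelow i (mono i m) := fun k hk => by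
  simp [mono, hk.ne]

theorem mono_act (i : ℤ) (m : M) (t : ℤ → A) (n : ℤ) :
    d.act (mono i m) t n = op (d.powX i t n) • m := by
  rw [act, finsum_eq_single _ i]
  · simp [mono]
  · intro k hk
    simp [mono, hk]

theorem leftX_mono_one (i : ℤ) : d.leftX (mono i (1 : A)) = mono (i + 1) 1 := by
  funext n
  rw [leftX]
  by_cases h1 : n = i
  · subst h1
    simp [mono, σ_one_δ]
  · by_cases h2 : n = i + 1
    · subst h2
      simp [mono]
    · have h3 : n - 1 ≠ i := by omega
      simp [mono, h1, h2, h3]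

theorem powX_mono_one (i : ℤ) : d.powX i (mono 0 (1 : A)) = mono i 1 := by
  induction i using Int.induction_on with
  | zero => exact d.powX_zero _
  | succ i ih => rw [add_comm, powX_one_add, ih, leftX_mono_one, add_comm]
  | pred i ih =>
    have h : d.leftX (d.powX (-(i : ℤ) - 1) (mono 0 (1 : A))) = d.leftX (mono (-(i : ℤ) - 1) 1) := by
      rw [← powX_one_add, leftX_mono_one, add_sub_cancel, sub_add_cancel, ih]
    rw [← d.leftXInv_leftX (d.powX _ _), h, leftXInv_leftX]

theorem act_one (s : ℤ → M) : d.act s (mono 0 1) = s := by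
  funext n
  simp only [act, powX_mono_one]
  rw [finsum_eq_single _ n]
  · simp [mono]
  · intro k hk
    simp [mono, hk.symm]

theorem one_act (t : ℤ → A) : d.act (mono 0 (1 : A)) t = t := by
  funext n
  simp [mono_act, powX_zero]

theorem leftX_act {i₀ j₀ : ℤ} {t u : ℤ → A} (ht : VanishBelow i₀ t) (hu : VanishBelow j₀ u) :
    d.leftX (d.act t u) = d.act (d.leftX t) u := by
  funext n
  obtain ⟨I, hI⟩ := hu.exists_powX_eq_zero d n
  obtain ⟨I', hI'⟩ := hu.exists_powX_eq_zero d (n - 1)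
  have h1 : ∀ i ≥ max I I', d.powX i u n = 0 := fun i hi => hI i (le_trans (le_max_left _ _) hi)
  have h1s : ∀ i ≥ max I I' + 1, d.powX i u n = 0 := fun i hi => h1 i (by omega)
  have h2 : ∀ i ≥ max I I', d.powX i u (n - 1) = 0 :=
    fun i hi => hI' i (le_trans (le_max_right _ _) hi)
  have hts : VanishBelow (i₀ + 1) (fun i => t (i - 1)) := fun k hk => ht _ (by omega)
  have hA : d.act (fun i => d.σ (t (i - 1))) u n =
      ∑ i ∈ Finset.Ico i₀ (max I I'), d.σ (t i) * d.powX (i + 1) u n := by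
    rw [act_eq_sum d (i₀ := i₀ + 1) (fun k hk => by simp [hts k hk]) h1s,
      ← Finset.sum_Ico_add' (fun i => op (d.powX i u n) • d.σ (t (i - 1)))]
    simp
  have hB : d.act (fun i => d.δ (t i)) u n =
      ∑ i ∈ Finset.Ico i₀ (max I I'), d.δ (t i) * d.powX i u n := by
    rw [act_eq_sum d (i₀ := i₀) (fun k hk => by simp [ht k hk]) h1]
    simp
  have hC : d.leftX t = (fun i => d.σ (t (i - 1))) + (fun i => d.δ (t i)) := rfl
  rw [hC, act_add_left d (i₀ := i₀ + 1) (i₁ := i₀) (fun k hk => by simp [hts k hk])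
    (fun k hk => by simp [ht k hk]) hu, Pi.add_apply, hA, hB, leftX, act_eq_sum d ht h1,
    act_eq_sum d ht h2, map_sum, map_sum, ← Finset.sum_add_distrib, ← Finset.sum_add_distrib]
  refine Finset.sum_congr rfl fun i _ => ?_
  rw [add_comm i 1, powX_one_add, leftX]
  simp only [op_smul_eq_mul, map_mul, d.leibniz, mul_add]
  abel

theorem powX_act {i₀ j₀ : ℤ} {t u : ℤ → A} (ht : VanishBelow i₀ t) (hu : VanishBelow j₀ u)
    (i : ℤ) : d.powX i (d.act t u) = d.act (d.powX i t) u := by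
  induction i using Int.induction_on with
  | zero => simp [powX_zero]
  | succ i ih =>
    obtain ⟨J, hJ⟩ := ht.exists_powX d i
    have h := hJ 0 i (by simp)
    rw [add_comm, powX_one_add, ih, powX_one_add, leftX_act d h hu]
  | pred i ih =>
    obtain ⟨J, hJ⟩ := ht.exists_powX d (-(i : ℤ) - 1)
    have h := hJ 0 (-(i : ℤ) - 1) (by simp)
    have e : d.leftX (d.powX (-(i : ℤ) - 1) (d.act t u)) =
        d.leftX (d.act (d.powX (-(i : ℤ) - 1) t) u) := by
      rw [leftX_act d h hu, ← powX_one_add, ← powX_one_add, add_sub_cancel, ih]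
    rw [← d.leftXInv_leftX (d.powX _ _), e, leftXInv_leftX]

theorem act_act {h₀ i₀ j₀ : ℤ} {s : ℤ → M} {t u : ℤ → A} (hs : VanishBelow h₀ s)
    (ht : VanishBelow i₀ t) (hu : VanishBelow j₀ u) :
    d.act (d.act s t) u = d.act s (d.act t u) := by
  funext n
  obtain ⟨K, hK⟩ := hu.exists_powX_eq_zero d n
  obtain ⟨J, hJ⟩ := ht.exists_powX d h₀
  have hst : VanishBelow J (d.act s t) := fun k hk => by
    refine finsum_eq_zero_of_forall_eq_zero fun i => ?_
    by_cases hi : i < h₀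
    · simp [hs i hi]
    · rw [hJ 0 i (by push_cast; omega) k (by push_cast; omega)]
      simp
  obtain ⟨I, hI⟩ : ∃ I : ℤ, ∀ i ≥ I, i ≥ h₀ → ∀ k < K, d.powX i t k = 0 := by
    refine ⟨h₀ + nilpotencyClass d.δ * ((K - J).toNat : ℕ), fun i hi _ k hk => ?_⟩
    exact hJ _ i hi k (by omega)
  have hI2 : ∀ i ≥ max I h₀, ∀ k < K, d.powX i t k = 0 := fun i hi k hk =>
    hI i (le_trans (le_max_left _ _) hi) (le_trans (le_max_right _ _) hi) k hk
  have hvb : ∀ i ∈ Finset.Ico h₀ (max I h₀), VanishBelow J (d.powX i t) := fun i hi => by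
    have := (Finset.mem_Ico.1 hi).1
    simpa using hJ 0 i (by push_cast; omega)
  have hL : d.act (d.act s t) u n = ∑ k ∈ Finset.Ico J K, ∑ i ∈ Finset.Ico h₀ (max I h₀),
      op (d.powX i t k * d.powX k u n) • s i := by
    rw [act_eq_sum d hst hK]
    refine Finset.sum_congr rfl fun k hk => ?_
    rw [act_eq_sum d hs (fun i hi => hI2 i hi k (Finset.mem_Ico.1 hk).2), Finset.smul_sum]
    refine Finset.sum_congr rfl fun i _ => ?_
    rw [smul_smul, op_mul]
  have hz : ∀ i ≥ max I h₀, d.powX i (d.act t u) n = 0 := fun i hi => by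
    rw [powX_act d ht hu]
    refine finsum_eq_zero_of_forall_eq_zero fun k => ?_
    by_cases hk : k < K
    · simp [hI2 i hi k hk]
    · simp [hK k (by omega)]
  rw [hL, act_eq_sum d hs hz, Finset.sum_comm]
  refine Finset.sum_congr rfl fun i hi => ?_
  rw [powX_act d ht hu, act_eq_sum d (hvb i hi) hK]
  simp only [op_smul_eq_mul]
  rw [← Finset.sum_smul, ← Finset.op_sum]

end Action

section LaurentRing

variable (d : NilSkewDerivation F A)

theorem exists_vanishBelow {N : Type*} [Zero N] (s : N⸨X⸩) : ∃ j, VanishBelow j s.coeff :=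
  ⟨s.order, fun _ hk => HahnSeries.coeff_eq_zero_of_lt_order hk⟩

/-- The Laurent series with the given sequence of coefficients, which vanishes in low degrees. -/
def ofVanish {N : Type*} [Zero N] (s : ℤ → N) (h : ∃ j, VanishBelow j s) : N⸨X⸩ :=
  HahnSeries.ofSuppBddBelow s <| by
    obtain ⟨j, hj⟩ := h
    exact ⟨j, fun k hk => not_lt.1 fun hlt => hk (hj k hlt)⟩

/-- The product of a Laurent series over `M` by a Laurent series over `A`, twisted by `(σ, δ)`. -/
def laurentAct (s : M⸨X⸩) (t : A⸨X⸩) : M⸨X⸩ :=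
  ofVanish (d.act s.coeff t.coeff) <| by
    obtain ⟨i, hi⟩ := exists_vanishBelow s
    obtain ⟨j, hj⟩ := exists_vanishBelow t
    exact hi.exists_act d hj

theorem coeff_laurentAct (s : M⸨X⸩) (t : A⸨X⸩) :
    (d.laurentAct s t).coeff = d.act s.coeff t.coeff := rfl

theorem laurentAct_laurentAct (s : M⸨X⸩) (t u : A⸨X⸩) :
    d.laurentAct (d.laurentAct s t) u = d.laurentAct s (d.laurentAct t u) := by
  obtain ⟨i, hi⟩ := exists_vanishBelow s
  obtain ⟨j, hj⟩ := exists_vanishBelow t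
  obtain ⟨k, hk⟩ := exists_vanishBelow u
  apply HahnSeries.ext
  simp only [coeff_laurentAct]
  exact d.act_act hi hj hk

theorem laurentAct_add (s : M⸨X⸩) (t u : A⸨X⸩) :
    d.laurentAct s (t + u) = d.laurentAct s t + d.laurentAct s u := by
  obtain ⟨i, hi⟩ := exists_vanishBelow s
  obtain ⟨j, hj⟩ := exists_vanishBelow t
  obtain ⟨k, hk⟩ := exists_vanishBelow u
  apply HahnSeries.ext
  simp only [coeff_laurentAct, HahnSeries.coeff_add']
  exact d.act_add_right hi hj hk

theorem add_laurentAct (s s' : M⸨X⸩) (t : A⸨X⸩) :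
    d.laurentAct (s + s') t = d.laurentAct s t + d.laurentAct s' t := by
  obtain ⟨i, hi⟩ := exists_vanishBelow s
  obtain ⟨j, hj⟩ := exists_vanishBelow s'
  obtain ⟨k, hk⟩ := exists_vanishBelow t
  apply HahnSeries.ext
  simp only [coeff_laurentAct, HahnSeries.coeff_add']
  exact d.act_add_left hi hj hk

theorem zero_laurentAct (t : A⸨X⸩) : d.laurentAct (0 : M⸨X⸩) t = 0 :=
  HahnSeries.ext (d.zero_act t.coeff)

theorem laurentAct_zero (s : M⸨X⸩) : d.laurentAct s (0 : A⸨X⸩) = 0 :=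
  HahnSeries.ext (d.act_zero s.coeff)

theorem coeff_single_eq_mono {N : Type*} [AddCommGroup N] (i : ℤ) (m : N) :
    (HahnSeries.single i m : N⸨X⸩).coeff = mono i m := by
  funext n
  by_cases h : n = i
  · subst h
    simp [mono]
  · simp [mono, h, HahnSeries.coeff_single_of_ne h]

theorem laurentAct_one (s : M⸨X⸩) : d.laurentAct s (HahnSeries.single 0 1) = s :=
  HahnSeries.ext (by rw [coeff_laurentAct, coeff_single_eq_mono, act_one])

theorem one_laurentAct (t : A⸨X⸩) : d.laurentAct (HahnSeries.single 0 (1 : A)) t = t :=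
  HahnSeries.ext (by rw [coeff_laurentAct, coeff_single_eq_mono, one_act])

end LaurentRing

end NilSkewDerivation

open NilSkewDerivation

section Rings

variable {F A M : Type*} [Field F] [Ring A] [Algebra F A]
  [AddCommGroup M] [Module F M] [Module Aᵐᵒᵖ M]

/-- The ring `A((X; σ, δ))` of left skew Laurent series: the left `A`-module of Laurent series with
coefficients in `A`, with the product `(∑ᵢ sᵢ Xⁱ) t = ∑ᵢ sᵢ (Xⁱ t)`, where `X t = σ(t) X + δ(t)`. -/
def SkewLaurentSeries (_d : NilSkewDerivation F A) : Type _ := A⸨X⸩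

namespace SkewLaurentSeries

variable (d : NilSkewDerivation F A)

instance : AddCommGroup (SkewLaurentSeries d) := inferInstanceAs (AddCommGroup A⸨X⸩)

instance : Ring (SkewLaurentSeries d) where
  __ := (inferInstance : AddCommGroup (SkewLaurentSeries d))
  mul s t := d.laurentAct (M := A) s t
  one := (HahnSeries.single 0 1 : A⸨X⸩)
  mul_assoc := d.laurentAct_laurentAct (M := A)
  one_mul := d.one_laurentAct
  mul_one := d.laurentAct_one (M := A)
  left_distrib := d.laurentAct_add (M := A)
  right_distrib := d.add_laurentAct (M := A)
  zero_mul := d.zero_laurentAct (M := A)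
  mul_zero := d.laurentAct_zero (M := A)

/-- The coefficients of a skew Laurent series. -/
def coeff {d : NilSkewDerivation F A} (s : SkewLaurentSeries d) : ℤ → A :=
  HahnSeries.coeff (Γ := ℤ) (R := A) s

variable {d}

@[ext]
theorem ext {s t : SkewLaurentSeries d} (h : s.coeff = t.coeff) : s = t :=
  HahnSeries.ext (Γ := ℤ) (R := A) h

theorem coeff_mul (s t : SkewLaurentSeries d) : (s * t).coeff = d.act s.coeff t.coeff := rfl

theorem coeff_add (s t : SkewLaurentSeries d) : (s + t).coeff = s.coeff + t.coeff := rfl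

theorem coeff_one : (1 : SkewLaurentSeries d).coeff = mono 0 1 := coeff_single_eq_mono 0 1

variable (d)

/-- The monomial `a Xⁱ` of `A((X; σ, δ))`. -/
def monomial (i : ℤ) (a : A) : SkewLaurentSeries d := (HahnSeries.single i a : A⸨X⸩)

theorem coeff_monomial (i : ℤ) (a : A) : (monomial d i a).coeff = mono i a :=
  coeff_single_eq_mono i a

/-- The coefficient ring `A` as a subring of `A((X; σ, δ))`. -/
def C : A →+* SkewLaurentSeries d where
  toFun := monomial d 0
  map_one' := rfl
  map_mul' a b := ext <| by
    rw [coeff_mul, coeff_monomial, coeff_monomial, coeff_monomial]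
    funext n
    rw [mono_act, powX_zero]
    by_cases h : n = 0
    · subst h
      simp [mono]
    · simp [mono, h]
  map_zero' := HahnSeries.single_eq_zero
  map_add' a b := map_add (HahnSeries.single.addMonoidHom (Γ := ℤ) 0) a b

theorem coeff_C (a : A) : (C d a).coeff = mono 0 a := coeff_monomial d 0 a

/-- Right multiplication by `X ^ l` shifts the coefficients. -/
theorem coeff_mul_monomial_one (s : SkewLaurentSeries d) (l n : ℤ) :
    (s * monomial d l 1).coeff n = s.coeff (n - l) := by
  rw [coeff_mul, coeff_monomial, act, finsum_eq_single _ (n - l)]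
  · rw [← powX_mono_one d l, ← powX_add, powX_mono_one]
    simp [mono]
  · intro k hk
    rw [← powX_mono_one d l, ← powX_add, powX_mono_one]
    have h : n ≠ k + l := by omega
    simp [mono, h]

/-- The commutation rule `X a = σ(a) X + δ(a)` of the skew Laurent series ring. -/
theorem X_mul_C (a : A) :
    monomial d 1 1 * C d a = C d (d.σ a) * monomial d 1 1 + C d (d.δ a) := by
  apply ext
  rw [coeff_add, coeff_mul, coeff_mul]
  funext n
  have h := powX_one_add d 0 (mono 0 a)
  rw [add_zero, powX_zero] at h
  simp only [coeff_C, coeff_monomial, Pi.add_apply, mono_act, powX_zero, h, leftX]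
  by_cases h1 : n = 1
  · subst h1
    simp [mono]
  · by_cases h0 : n = 0
    · subst h0
      simp [mono]
    · have h2 : n - 1 ≠ 0 := by omega
      simp [mono, h1, h0, h2]

/-- For a right `A`-module `M`, the right `A((X; σ, δ))`-module structure on the Laurent series
with coefficients in `M`, given by `(∑ᵢ sᵢ Xⁱ) t = ∑ᵢ sᵢ (Xⁱ t)`. -/
instance : Module (SkewLaurentSeries d)ᵐᵒᵖ (HahnModule ℤ F M) where
  smul t s := HahnModule.of F (d.laurentAct ((HahnModule.of F).symm s) t.unop)
  one_smul := d.laurentAct_one (M := M)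
  mul_smul t u s := (d.laurentAct_laurentAct (M := M) s u.unop t.unop).symm
  smul_zero t := d.zero_laurentAct (M := M) t.unop
  smul_add t s s' := d.add_laurentAct (M := M) s s' t.unop
  add_smul t u s := d.laurentAct_add (M := M) s t.unop u.unop
  zero_smul := d.laurentAct_zero (M := M)

theorem coeff_smul (t : SkewLaurentSeries d) (s : HahnModule ℤ F M) :
    ((HahnModule.of F).symm (op t • s)).coeff = d.act ((HahnModule.of F).symm s).coeff t.coeff :=
  rfl

end SkewLaurentSeries

section Polynomials

/-- A polynomial with coefficients in `N` as a two-sided sequence. -/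
def polySeq {N : Type*} [Zero N] (p : ℕ →₀ N) : ℤ → N := fun n => if 0 ≤ n then p n.toNat else 0

theorem vanishBelow_polySeq {N : Type*} [Zero N] (p : ℕ →₀ N) : VanishBelow 0 (polySeq p) :=
  fun k hk => by simp [polySeq, hk]

theorem polySeq_add {N : Type*} [AddZeroClass N] (p q : ℕ →₀ N) :
    polySeq (p + q) = polySeq p + polySeq q := by
  funext n
  by_cases h : 0 ≤ n <;> simp [polySeq, h]

theorem polySeq_zero {N : Type*} [Zero N] : polySeq (0 : ℕ →₀ N) = 0 := by
  funext n
  simp [polySeq]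

theorem polySeq_injective {N : Type*} [Zero N] :
    Function.Injective (polySeq : (ℕ →₀ N) → ℤ → N) := fun p q h => by
  ext n
  simpa [polySeq] using congrFun h n

theorem polySeq_single (i : ℕ) (m : M) : polySeq (Finsupp.single i m) = mono (i : ℤ) m := by
  funext n
  by_cases h : n = i
  · subst h
    simp [polySeq, mono]
  · by_cases h0 : 0 ≤ n
    · have : i ≠ n.toNat := by omega
      simp [polySeq, mono, h, this]
    · simp [polySeq, mono, h, h0]

/-- The inclusion of `M[X]` in `M((X))`. -/
def polyToLaurent (p : PolynomialModule F M) : HahnModule ℤ F M :=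
  HahnModule.of F (ofVanish (polySeq p.coeff) ⟨0, vanishBelow_polySeq _⟩)

end Polynomials

/-- The skew polynomial ring `A[X; σ, δ]`: the left `A`-module of polynomials with coefficients in
`A`, with the product `(∑ᵢ fᵢ Xⁱ) g = ∑ᵢ fᵢ (Xⁱ g)`, where `X g = σ(g) X + δ(g)`. -/
def SkewPolynomialRing (_d : NilSkewDerivation F A) : Type _ := PolynomialModule F A

namespace SkewPolynomialRing

variable (d : NilSkewDerivation F A)

instance : AddCommGroup (SkewPolynomialRing d) :=
  inferInstanceAs (AddCommGroup (PolynomialModule F A))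

/-- The usual `F[X]`-module structure on the polynomials with coefficients in `A`. -/
instance : Module F[X] (SkewPolynomialRing d) :=
  inferInstanceAs (Module F[X] (PolynomialModule F A))

/-- Left multiplication by `X`: `X g = σ(g) X + δ(g)`. -/
def leftX (g : ℕ →₀ A) : ℕ →₀ A :=
  Finsupp.mapDomain Nat.succ (g.mapRange d.σ (map_zero d.σ)) + g.mapRange d.δ (map_zero d.δ)

/-- The product `(∑ᵢ fᵢ Xⁱ) g = ∑ᵢ fᵢ (Xⁱ g)`. -/
def mulCoeff (f g : ℕ →₀ A) : ℕ →₀ A := f.sum fun i a => a • (leftX d)^[i] g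

theorem polySeq_leftX (g : ℕ →₀ A) : polySeq (leftX d g) = d.leftX (polySeq g) := by
  funext n
  rw [NilSkewDerivation.leftX]
  rcases lt_trichotomy n 0 with h | rfl | h
  · simp [polySeq, not_le.2 h, show ¬ (1 ≤ n) by omega]
  · have h0 : (0 : ℕ) ∉ Set.range Nat.succ := by simp
    simp [polySeq, leftX, Finsupp.mapDomain_of_notMem_range _ _ h0]
  · obtain ⟨k, rfl⟩ : ∃ k : ℕ, n = k + 1 := ⟨(n - 1).toNat, by omega⟩
    have e : ((k : ℤ) + 1).toNat = k.succ := by omega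
    have h1 : (0 : ℤ) ≤ k + 1 := by omega
    simp [polySeq, leftX, e, h1, -Nat.succ_eq_add_one,
      Finsupp.mapDomain_apply Nat.succ_injective]

theorem polySeq_mulCoeff (f g : ℕ →₀ A) :
    polySeq (mulCoeff d f g) = d.act (polySeq f) (polySeq g) := by
  induction f using Finsupp.induction_linear with
  | zero => rw [mulCoeff, Finsupp.sum_zero_index, polySeq_zero, zero_act]
  | add f f' hf hf' =>
    rw [polySeq_add, act_add_left d (vanishBelow_polySeq f) (vanishBelow_polySeq f')
      (vanishBelow_polySeq g), ← hf, ← hf', ← polySeq_add]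
    congr 1
    exact Finsupp.sum_add_index' (by simp) (by simp [add_smul])
  | single i a =>
    have hp : ∀ r : ℕ, polySeq ((leftX d)^[r] g) = d.powX r (polySeq g) := fun r => by
      induction r with
      | zero => simp [powX_zero]
      | succ r ih =>
        rw [Function.iterate_succ_apply', polySeq_leftX, ih, Nat.cast_succ, add_comm,
          powX_one_add]
    rw [mulCoeff, Finsupp.sum_single_index (by simp), polySeq_single]
    funext n
    rw [mono_act, ← hp]
    by_cases h : 0 ≤ n <;> simp [polySeq, h]

instance : Mul (SkewPolynomialRing d) :=
  ⟨fun f g => PolynomialModule.ofCoeff F (mulCoeff d f.coeff g.coeff)⟩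

instance : One (SkewPolynomialRing d) := ⟨PolynomialModule.single F 0 (1 : A)⟩

/-- The inclusion of `A[X; σ, δ]` in `A((X; σ, δ))`, as a map. -/
def toLaurentFun (f : SkewPolynomialRing d) : SkewLaurentSeries d :=
  (ofVanish (polySeq (PolynomialModule.coeff f)) ⟨0, vanishBelow_polySeq _⟩ : A⸨X⸩)

theorem toLaurentFun_injective : Function.Injective (toLaurentFun d) := fun _ _ h =>
  PolynomialModule.coeff_injective (R := F) (M := A)
    (polySeq_injective (congrArg SkewLaurentSeries.coeff h))

theorem toLaurentFun_mul (f g : SkewPolynomialRing d) :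
    toLaurentFun d (f * g) = toLaurentFun d f * toLaurentFun d g :=
  SkewLaurentSeries.ext (polySeq_mulCoeff d _ _)

theorem toLaurentFun_add (f g : SkewPolynomialRing d) :
    toLaurentFun d (f + g) = toLaurentFun d f + toLaurentFun d g :=
  SkewLaurentSeries.ext (polySeq_add _ _)

theorem toLaurentFun_zero : toLaurentFun d 0 = 0 := SkewLaurentSeries.ext polySeq_zero

theorem toLaurentFun_one : toLaurentFun d 1 = 1 :=
  SkewLaurentSeries.ext ((polySeq_single 0 (1 : A)).trans SkewLaurentSeries.coeff_one.symm)

instance : Ring (SkewPolynomialRing d) where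
  __ := (inferInstance : AddCommGroup (SkewPolynomialRing d))
  __ := (inferInstance : Mul (SkewPolynomialRing d))
  __ := (inferInstance : One (SkewPolynomialRing d))
  mul_assoc f g h := toLaurentFun_injective d (by simp only [toLaurentFun_mul, mul_assoc])
  one_mul f := toLaurentFun_injective d (by rw [toLaurentFun_mul, toLaurentFun_one, one_mul])
  mul_one f := toLaurentFun_injective d (by rw [toLaurentFun_mul, toLaurentFun_one, mul_one])
  left_distrib f g h := toLaurentFun_injective d
    (by simp only [toLaurentFun_mul, toLaurentFun_add, mul_add])
  right_distrib f g h := toLaurentFun_injective d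
    (by simp only [toLaurentFun_mul, toLaurentFun_add, add_mul])
  zero_mul f := toLaurentFun_injective d
    (by rw [toLaurentFun_mul, toLaurentFun_zero, zero_mul])
  mul_zero f := toLaurentFun_injective d
    (by rw [toLaurentFun_mul, toLaurentFun_zero, mul_zero])

/-- The inclusion of `A[X; σ, δ]` as a subring of `A((X; σ, δ))`. -/
def toLaurent : SkewPolynomialRing d →+* SkewLaurentSeries d where
  toFun := toLaurentFun d
  map_one' := toLaurentFun_one d
  map_mul' := toLaurentFun_mul d
  map_zero' := toLaurentFun_zero d
  map_add' := toLaurentFun_add d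

end SkewPolynomialRing

/-- A convolutional code of length `n`: a (finite-dimensional) `F((X))`-subspace of `Fⁿ((X))` with a
basis of vectors in `Fⁿ[X]`. -/
def IsConvolutionalCode {n : ℕ} (D : Submodule F⸨X⸩ (HahnModule ℤ F (Fin n → F))) : Prop :=
  ∃ (k : ℕ) (b : Module.Basis (Fin k) F⸨X⸩ D),
    ∀ i, ∃ p : PolynomialModule F (Fin n → F), (b i : HahnModule ℤ F (Fin n → F)) = polyToLaurent p

/-- For a right `A`-module structure on `Fⁿ`, a `(σ, δ, A)`-cyclic convolutional code is a
convolutional code that is a right `A`-submodule of `Fⁿ((X))`. -/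
def IsCyclicConvolutionalCode (d : NilSkewDerivation F A) {n : ℕ} [Module Aᵐᵒᵖ (Fin n → F)]
    (D : Submodule F⸨X⸩ (HahnModule ℤ F (Fin n → F))) : Prop :=
  IsConvolutionalCode D ∧ ∀ (a : A), ∀ s ∈ D, op (SkewLaurentSeries.C d a) • s ∈ D

/-- The `(σ, δ, A)`-cyclic convolutional codes in `A((X; σ, δ))`, with `A((X; σ, δ))` identified with
`Fⁿ((X))` coefficientwise by an isomorphism `φ` of `A` with `Fⁿ`. -/
def cyclicCodesInLaurent (d : NilSkewDerivation F A) {n : ℕ} [Module Aᵐᵒᵖ (Fin n → F)]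
    (φ : A ≃ₗ[F] (Fin n → F)) : Set (Set (SkewLaurentSeries d)) :=
  {D | ∃ D' : Submodule F⸨X⸩ (HahnModule ℤ F (Fin n → F)), IsCyclicConvolutionalCode d D' ∧
    D = {s : SkewLaurentSeries d | HahnModule.of F (HahnSeries.map (Γ := ℤ) (R := A) s φ) ∈ D'}}

/-- The right ideal codes: the right ideals of `A[X; σ, δ]` that are `F[X]`-direct summands. -/
def rightIdealCodes (d : NilSkewDerivation F A) : Set (Set (SkewPolynomialRing d)) :=
  {I | (∃ J : Submodule (SkewPolynomialRing d)ᵐᵒᵖ (SkewPolynomialRing d), (J : Set _) = I) ∧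
    ∃ P Q : Submodule F[X] (SkewPolynomialRing d), (P : Set _) = I ∧ IsCompl P Q}

end Rings

end

/-!
Applying `φ` to the coefficients identifies `A((X; σ, δ))` with `Fⁿ((X))`. Since `σ` fixes `F` and
`δ` kills it, the series over `F` satisfy `X c = c X`, and right multiplication by such a series in
`A((X; σ, δ))` becomes scalar multiplication by `F((X))` (`SkewLaurentSeries.coords_mul_ofField`).
Moreover every skew Laurent series `t` is a finite sum `∑ aⱼ cⱼ` with `aⱼ` in a basis of `A` and
`cⱼ ∈ F((X))`, so that `w t = ∑ cⱼ • (w aⱼ)` (`SkewLaurentSeries.op_smul_eq_sum`).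

* If `D` is a cyclic convolutional code, it is therefore stable under all of `A((X; σ, δ))`, and
  its polynomials form a right ideal. They form a saturated `F[X]`-submodule of the finite module
  `A[X]`, hence a direct summand (`Submodule.exists_isCompl_of_saturated`).
* A convolutional code is spanned by its polynomials, so it is determined by them
  (`IsConvolutionalCode.le_of_polynomialPart_le`).
* If `I` is a right ideal code, its `F((X))`-span `D` has a basis of polynomials
  (`isConvolutionalCode_span`). For `f ∈ I` the product `f t = ∑ cⱼ • (f aⱼ)` lies in `D`; as
  `(c • f) t = f (c t)`, the span is stable under `A((X; σ, δ))`. Finally the projection of `A[X]`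
  with kernel `I` extends to an `F((X))`-linear map of `Fⁿ((X))` that kills `D`, so `D` contains no
  polynomials outside `I` (`SkewPolynomialRing.mem_of_coords_mem_span`).
-/

/-! ### Laurent series with coefficients in a vector space -/

namespace HahnModule

/-- Applying an `F`-linear map to the coefficients is `F((X))`-linear. -/
theorem of_map_smul {F V V' : Type*} [Field F] [AddCommGroup V] [Module F V] [AddCommGroup V']
    [Module F V'] (f : V →ₗ[F] V') (c : F⸨X⸩) (w : HahnModule ℤ F V) :
    of F (((of F).symm (c • w)).map f) = c • of F (((of F).symm w).map f) := by
  have hsub : (((of F).symm w).map f).support ⊆ ((of F).symm w).support := fun i hi h0 =>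
    hi (by rw [HahnSeries.map_coeff, h0, map_zero])
  ext n
  have h : f (((of F).symm (c • w)).coeff n) =
      ((of F).symm (c • of F (((of F).symm w).map f))).coeff n := by
    rw [coeff_smul_right (y := of F (((of F).symm w).map f))
      ((of F).symm w).isPWO_support hsub, coeff_smul, map_sum]
    exact Finset.sum_congr rfl fun x _ => map_smul f _ _
  exact h

theorem coeff_smul_eq_finsum {F V : Type*} [Field F] [AddCommGroup V] [Module F V]
    (c : F⸨X⸩) (w : HahnModule ℤ F V) (n : ℤ) :
    ((of F).symm (c • w)).coeff n =
      ∑ᶠ i : ℤ, c.coeff (n - i) • ((of F).symm w).coeff i := by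
  classical
  rw [coeff_smul, finsum_eq_sum_of_support_subset (s := (Finset.VAddAntidiagonal n
    (Set.VAddAntidiagonal.finite_of_isPWO c.isPWO_support
      ((of F).symm w).isPWO_support n)).image Prod.snd)]
  · rw [Finset.sum_image]
    · refine Finset.sum_congr rfl fun x hx => ?_
      have := ((Finset.mem_vaddAntidiagonal _ _).1 hx).2.2
      rw [vadd_eq_add] at this
      rw [show n - x.2 = x.1 by omega]
    · intro x hx y hy h
      have h1 := ((Finset.mem_vaddAntidiagonal _ _).1 hx).2.2
      have h2 := ((Finset.mem_vaddAntidiagonal _ _).1 hy).2.2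
      rw [vadd_eq_add] at h1 h2
      exact Prod.ext (by omega) h
  · intro i hi
    rw [Function.mem_support] at hi
    refine Finset.mem_coe.2 (Finset.mem_image.2 ⟨(n - i, i), ?_, rfl⟩)
    refine (Finset.mem_vaddAntidiagonal _ _).2 ⟨fun h => hi ?_, fun h => hi ?_, by simp⟩
    · simp [h]
    · simp [h]

/-- The Laurent series of `j`-th coordinates of a Laurent series with coefficients in `Fⁿ`. -/
noncomputable def component (F : Type*) [Field F] {n : ℕ} (j : Fin n) :
    HahnModule ℤ F (Fin n → F) →ₗ[F⸨X⸩] F⸨X⸩ where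
  toFun w := ((of F).symm w).map (LinearMap.proj (R := F) (φ := fun _ : Fin n => F) j)
  map_add' v w := by ext k; simp
  map_smul' c w := of_map_smul (LinearMap.proj (R := F) (φ := fun _ : Fin n => F) j) c w

theorem ext_component {F : Type*} [Field F] {n : ℕ} {v w : HahnModule ℤ F (Fin n → F)}
    (h : ∀ j, component F j v = component F j w) : v = w := by
  ext k j
  exact congrArg (fun s : F⸨X⸩ => s.coeff k) (h j)

instance {F : Type*} [Field F] {n : ℕ} :
    FiniteDimensional F⸨X⸩ (HahnModule ℤ F (Fin n → F)) :=
  Module.Finite.of_injective (LinearMap.pi fun j : Fin n => component F j)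
    fun _ _ h => ext_component fun j => congrFun h j

theorem component_single {F : Type*} [Field F] {n : ℕ} (j : Fin n) (k : ℤ) (v : Fin n → F) :
    component F j (of F (HahnSeries.single k v)) = HahnSeries.single k (v j) :=
  HahnSeries.map_single (⟨fun u => u j, rfl⟩ : ZeroHom (Fin n → F) F)

theorem eq_sum_component_smul {F : Type*} [Field F] {n : ℕ} (w : HahnModule ℤ F (Fin n → F)) :
    w = ∑ j, component F j w • of F (HahnSeries.single 0 (Pi.single j 1)) := by
  refine ext_component fun l => ?_
  rw [map_sum, Finset.sum_eq_single l]
  · rw [map_smul, component_single, Pi.single_eq_same, HahnSeries.single_zero_one, smul_eq_mul,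
      mul_one]
  · intro j _ hj
    rw [map_smul, component_single, Pi.single_eq_of_ne hj.symm, HahnSeries.single_eq_zero,
      smul_zero]
  · simp

end HahnModule

/-! ### Algebra over `F[X]` -/

theorem Polynomial.algebraMap_monomial_laurentSeries {F : Type*} [Field F] (j : ℕ) (r : F) :
    algebraMap F[X] F⸨X⸩ (Polynomial.monomial j r) = HahnSeries.single (j : ℤ) r := by
  rw [← Polynomial.C_mul_X_pow_eq_monomial, map_mul, map_pow]
  simp

/-- Over a principal ideal domain, a saturated submodule of a finite module is a direct summand:
the quotient is torsion-free, hence free. -/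
theorem Submodule.exists_isCompl_of_saturated {R N : Type*} [CommRing R] [IsDomain R]
    [IsPrincipalIdealRing R] [AddCommGroup N] [Module R N] [Module.Finite R N]
    (P : Submodule R N) (hP : ∀ (p : R) (x : N), p ≠ 0 → p • x ∈ P → x ∈ P) :
    ∃ Q : Submodule R N, IsCompl P Q := by
  have : Module.IsTorsionFree R (N ⧸ P) := by
    rw [Module.isTorsionFree_iff_smul_eq_zero]
    intro r x h
    induction x using Submodule.Quotient.induction_on with
    | _ x =>
      rw [← Submodule.Quotient.mk_smul, Submodule.Quotient.mk_eq_zero] at h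
      rw [Submodule.Quotient.mk_eq_zero, or_iff_not_imp_left]
      exact fun hr => hP r x hr h
  have := Module.free_of_finite_type_torsion_free' (R := R) (M := N ⧸ P)
  obtain ⟨g, hg⟩ := P.mkQ.exists_rightInverse_of_surjective P.range_mkQ
  have hg' : ∀ y, P.mkQ (g y) = y := fun y => LinearMap.congr_fun hg y
  refine ⟨LinearMap.range g, Submodule.disjoint_def.2 ?_, codisjoint_iff_le_sup.2 fun x _ => ?_⟩
  · rintro _ hx ⟨y, rfl⟩
    rw [← hg' y, P.mkQ_apply (g y), (Submodule.Quotient.mk_eq_zero P).2 hx, map_zero]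
  · refine Submodule.mem_sup.2 ⟨x - g (P.mkQ x), ?_, g (P.mkQ x), ⟨_, rfl⟩, sub_add_cancel _ _⟩
    rw [← Submodule.Quotient.mk_eq_zero, ← P.mkQ_apply, map_sub, hg', sub_self]

open NilSkewDerivation

noncomputable section

/-! ### Coordinates of skew Laurent series -/

namespace SkewLaurentSeries

variable {F A : Type*} [Field F] [Ring A] [Algebra F A] (d : NilSkewDerivation F A)

/-- The Laurent series with coefficients in the base field `F`, as skew Laurent series. -/
def ofField (c : F⸨X⸩) : SkewLaurentSeries d := (c.map (algebraMap F A) : A⸨X⸩)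

theorem coeff_ofField (c : F⸨X⸩) (n : ℤ) :
    (ofField d c).coeff n = algebraMap F A (c.coeff n) := rfl

/-- Since `σ` fixes `F` and `δ` kills it, `X` commutes with the series over `F`. -/
theorem powX_coeff_ofField (c : F⸨X⸩) (i : ℤ) :
    d.powX i (ofField d c).coeff = fun n => algebraMap F A (c.coeff (n - i)) := by
  have hδ (r : F) : d.δ (algebraMap F A r) = 0 := by
    rw [Algebra.algebraMap_eq_smul_one, map_smul, d.σ_one_δ, smul_zero]
  have hX (i : ℤ) : d.leftX (fun n => algebraMap F A (c.coeff (n - i))) =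
      fun n => algebraMap F A (c.coeff (n - (1 + i))) := by
    funext n
    rw [leftX, hδ, add_zero, AlgEquiv.commutes, sub_sub]
  induction i using Int.induction_on with
  | zero => simp [powX_zero, funext (coeff_ofField d c)]
  | succ i ih => rw [add_comm, powX_one_add, ih, hX]
  | pred i ih =>
    -- Both sides agree after applying the injective map `leftX`.
    rw [← d.leftXInv_leftX (d.powX _ _), ← powX_one_add, add_sub_cancel, ih,
      ← d.leftXInv_leftX (fun n => algebraMap F A (c.coeff (n - (-(i : ℤ) - 1)))), hX,
      add_sub_cancel]

theorem coeff_mul_ofField (s : SkewLaurentSeries d) (c : F⸨X⸩) (n : ℤ) :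
    (s * ofField d c).coeff n = ∑ᶠ i : ℤ, c.coeff (n - i) • s.coeff i := by
  rw [coeff_mul, act]
  refine finsum_congr fun i => ?_
  rw [powX_coeff_ofField, op_smul_eq_mul, Algebra.smul_def, Algebra.commutes]

variable {n : ℕ} (φ : A ≃ₗ[F] (Fin n → F))

/-- The identification of `A((X; σ, δ))` with `Fⁿ((X))`, applying `φ` to the coefficients. -/
def coords : SkewLaurentSeries d →+ HahnModule ℤ F (Fin n → F) where
  toFun s := HahnModule.of F (HahnSeries.map (Γ := ℤ) (R := A) s φ)
  map_zero' := HahnModule.ext _ _ (funext fun _ => map_zero φ)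
  map_add' s t := HahnModule.ext _ _ (funext fun k => map_add φ (s.coeff k) (t.coeff k))

theorem coeff_coords (s : SkewLaurentSeries d) (k : ℤ) :
    ((HahnModule.of F).symm (coords d φ s)).coeff k = φ (s.coeff k) := rfl

theorem coords_injective : Function.Injective (coords d φ) := fun _ _ h =>
  ext <| funext fun k => φ.injective <|
    congrArg (fun w => ((HahnModule.of F).symm w).coeff k) h

theorem coords_surjective : Function.Surjective (coords d φ) := fun w =>
  ⟨(((HahnModule.of F).symm w).map φ.symm : A⸨X⸩), by
    ext k : 2
    exact φ.apply_symm_apply _⟩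

/-- Right multiplication by a series over `F` is the `F((X))`-scalar action on `Fⁿ((X))`. -/
theorem coords_mul_ofField (s : SkewLaurentSeries d) (c : F⸨X⸩) :
    coords d φ (s * ofField d c) = c • coords d φ s := by
  have h : coords d φ (s * ofField d c) = HahnModule.of F (HahnSeries.map
      ((HahnModule.of F).symm (c • HahnModule.of F (s : A⸨X⸩))) φ.toLinearMap) := by
    ext k : 2
    exact congrArg φ ((coeff_mul_ofField d s c k).trans
      (HahnModule.coeff_smul_eq_finsum c (HahnModule.of F (s : A⸨X⸩)) k).symm)
  rw [h, HahnModule.of_map_smul]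
  rfl

theorem coords_mul [Module Aᵐᵒᵖ (Fin n → F)] (hφ : ∀ a b : A, φ (a * b) = op b • φ a)
    (s t : SkewLaurentSeries d) : coords d φ (s * t) = op t • coords d φ s := by
  ext k : 2
  rw [coeff_smul, coeff_coords, coeff_mul]
  obtain ⟨i₀, hi₀⟩ := exists_vanishBelow (N := A) s
  obtain ⟨j₀, hj₀⟩ := exists_vanishBelow (N := A) t
  obtain ⟨I, hI⟩ := hj₀.exists_powX_eq_zero d k
  have hs : VanishBelow i₀ ((HahnModule.of F).symm (coords d φ s)).coeff := fun i hi =>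
    (congrArg φ (hi₀ i hi)).trans (map_zero φ)
  refine ((congrArg φ (act_eq_sum d hi₀ hI)).trans ?_).trans (act_eq_sum d hs hI).symm
  rw [map_sum]
  exact Finset.sum_congr rfl fun i _ => hφ _ _

theorem coords_C (a : A) : coords d φ (C d a) = HahnModule.of F (HahnSeries.single 0 (φ a)) :=
  congrArg (HahnModule.of F) (HahnSeries.map_single (⟨φ, map_zero φ⟩ : ZeroHom A (Fin n → F)))

/-- Every skew Laurent series is a right combination of a basis of `A` with coefficients in the
field `F((X))`. -/
theorem eq_sum_C_mul_ofField (t : SkewLaurentSeries d) :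
    t = ∑ j, C d (φ.symm (Pi.single j 1)) *
      ofField d (HahnModule.component F j (coords d φ t)) := by
  apply coords_injective d φ
  rw [map_sum]
  simp only [coords_mul_ofField, coords_C, LinearEquiv.apply_symm_apply]
  exact HahnModule.eq_sum_component_smul _

/-- The right action of a skew Laurent series is an `F((X))`-combination of actions of elements of
`A`, so an `F((X))`-subspace stable under `A` is stable under `A((X; σ, δ))`. -/
theorem op_smul_eq_sum [Module Aᵐᵒᵖ (Fin n → F)] (hφ : ∀ a b : A, φ (a * b) = op b • φ a)
    (t : SkewLaurentSeries d) (w : HahnModule ℤ F (Fin n → F)) :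
    op t • w = ∑ j, HahnModule.component F j (coords d φ t) •
      op (C d (φ.symm (Pi.single j 1))) • w := by
  obtain ⟨s, rfl⟩ := coords_surjective d φ w
  conv_lhs => rw [eq_sum_C_mul_ofField d φ t, ← coords_mul d φ hφ, Finset.mul_sum, map_sum]
  simp only [← mul_assoc, coords_mul_ofField]
  simp only [coords_mul d φ hφ]

end SkewLaurentSeries

/-! ### Skew polynomials as vectors of Laurent series -/

namespace SkewPolynomialRing

variable {F A : Type*} [Field F] [Ring A] [Algebra F A] (d : NilSkewDerivation F A)

/-- The monomial `a Xʲ` of `A[X; σ, δ]`. -/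
def monomial (j : ℕ) (a : A) : SkewPolynomialRing d := PolynomialModule.single F j a

variable {d} in
theorem induction_monomial {motive : SkewPolynomialRing d → Prop} (f : SkewPolynomialRing d)
    (zero : motive 0) (add : ∀ f g, motive f → motive g → motive (f + g))
    (monomial : ∀ j a, motive (monomial d j a)) : motive f :=
  PolynomialModule.induction_linear f zero add monomial

theorem monomial_smul_monomial (i j : ℕ) (r : F) (a : A) :
    Polynomial.monomial i r • monomial d j a = monomial d (i + j) (r • a) :=
  PolynomialModule.monomial_smul_single ..

theorem monomial_sum {ι : Type*} (s : Finset ι) (j : ℕ) (a : ι → A) :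
    monomial d j (∑ i ∈ s, a i) = ∑ i ∈ s, monomial d j (a i) :=
  map_sum (PolynomialModule.lsingle F j) a s

theorem toLaurent_monomial_zero (a : A) :
    toLaurent d (monomial d 0 a) = SkewLaurentSeries.C d a :=
  SkewLaurentSeries.ext ((polySeq_single 0 a).trans (SkewLaurentSeries.coeff_C d a).symm)

variable {n : ℕ} (φ : A ≃ₗ[F] (Fin n → F))

theorem monomial_eq_sum (j : ℕ) (a : A) : monomial d j a =
    ∑ k, Polynomial.monomial j (φ a k) • monomial d 0 (φ.symm (Pi.single k 1)) := by
  simp only [monomial_smul_monomial, add_zero, ← monomial_sum, ← map_smul, ← map_sum]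
  congr 1
  rw [LinearEquiv.eq_symm_apply]
  exact pi_eq_sum_univ' (φ a)

instance [FiniteDimensional F A] : Module.Finite F[X] (SkewPolynomialRing d) := by
  let φ := (Module.finBasis F A).equivFun
  refine Module.finite_def.2 (Submodule.fg_def.2
    ⟨Set.range fun k => monomial d 0 (φ.symm (Pi.single k 1)), Set.finite_range _,
      top_unique fun f _ => ?_⟩)
  induction f using induction_monomial with
  | zero => exact zero_mem _
  | add f g hf hg => exact add_mem (hf trivial) (hg trivial)
  | monomial j a =>
    rw [monomial_eq_sum d φ]
    exact sum_mem fun k _ => Submodule.smul_mem _ _ (Submodule.subset_span ⟨k, rfl⟩)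

/-- The embedding of `A[X; σ, δ]` in `Fⁿ((X))`, applying `φ` to the coefficients. -/
def coords : SkewPolynomialRing d →+ HahnModule ℤ F (Fin n → F) :=
  (SkewLaurentSeries.coords d φ).comp (toLaurent d).toAddMonoidHom

theorem coords_injective : Function.Injective (coords d φ) :=
  (SkewLaurentSeries.coords_injective d φ).comp (toLaurentFun_injective d)

theorem coords_eq_polyToLaurent (f : SkewPolynomialRing d) :
    coords d φ f = polyToLaurent (PolynomialModule.map F φ.toLinearMap f) := by
  refine HahnModule.ext _ _ (funext fun k => ?_)
  change φ (polySeq (PolynomialModule.coeff f) k) =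
    polySeq (Finsupp.mapRange φ (map_zero φ) (PolynomialModule.coeff f)) k
  by_cases h : 0 ≤ k <;> simp [polySeq, h]

theorem exists_coords_eq_polyToLaurent (p : PolynomialModule F (Fin n → F)) :
    ∃ f, coords d φ f = polyToLaurent p := by
  refine ⟨PolynomialModule.map F φ.symm.toLinearMap p, ?_⟩
  refine (coords_eq_polyToLaurent d φ _).trans (congrArg polyToLaurent ?_)
  refine PolynomialModule.ext (Finsupp.ext fun k => ?_)
  exact φ.apply_symm_apply (p.coeff k)

theorem coords_monomial (j : ℕ) (a : A) :
    coords d φ (monomial d j a) = HahnModule.of F (HahnSeries.single (j : ℤ) (φ a)) := by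
  rw [coords_eq_polyToLaurent]
  refine HahnModule.ext _ _ ?_
  change polySeq (PolynomialModule.map F φ.toLinearMap (PolynomialModule.single F j a)).coeff =
    (HahnSeries.single (j : ℤ) (φ a)).coeff
  rw [PolynomialModule.map_single, coeff_single_eq_mono, PolynomialModule.coeff_single,
    polySeq_single]
  rfl

theorem coords_smul (p : F[X]) (f : SkewPolynomialRing d) :
    coords d φ (p • f) = algebraMap F[X] F⸨X⸩ p • coords d φ f := by
  induction f using induction_monomial with
  | zero => simp
  | add f g hf hg => rw [smul_add, map_add, map_add, hf, hg, smul_add]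
  | monomial j a =>
    induction p using Polynomial.induction_on' with
    | add p q hp hq => 
      rw [add_smul, map_add, map_add, hp, hq]
      exact (add_smul _ _ _).symm
    | monomial i r =>
      rw [monomial_smul_monomial, coords_monomial, coords_monomial,
        Polynomial.algebraMap_monomial_laurentSeries]
      refine HahnModule.ext_component fun k => ?_
      rw [(HahnModule.component F k).map_smul, HahnModule.component_single,
        HahnModule.component_single, smul_eq_mul, HahnSeries.single_mul_single, φ.map_smul,
        Nat.cast_add]
      rfl

/-- The `F((X))`-linear extension to `Fⁿ((X))` of an `F[X]`-linear endomorphism of `A[X]`. -/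
def extend (π : SkewPolynomialRing d →ₗ[F[X]] SkewPolynomialRing d) :
    HahnModule ℤ F (Fin n → F) →ₗ[F⸨X⸩] HahnModule ℤ F (Fin n → F) :=
  ∑ k, (HahnModule.component F k).smulRight
    (coords d φ (π (monomial d 0 (φ.symm (Pi.single k 1)))))

theorem extend_coords (π : SkewPolynomialRing d →ₗ[F[X]] SkewPolynomialRing d)
    (f : SkewPolynomialRing d) : extend d φ π (coords d φ f) = coords d φ (π f) := by
  induction f using induction_monomial with
  | zero => simp
  | add f g hf hg => rw [map_add, map_add, hf, hg, map_add, map_add]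
  | monomial j a =>
    rw [coords_monomial, monomial_eq_sum d φ j a, map_sum, map_sum]
    simp only [extend, LinearMap.sum_apply, LinearMap.smulRight_apply,
      HahnModule.component_single, map_smul, coords_smul,
      Polynomial.algebraMap_monomial_laurentSeries]

/-- A direct summand of `A[X]` contains every polynomial of its `F((X))`-span: the projection
of `A[X]` with this kernel extends `F((X))`-linearly. -/
theorem mem_of_coords_mem_span {P Q : Submodule F[X] (SkewPolynomialRing d)} (h : IsCompl P Q)
    {f : SkewPolynomialRing d}
    (hf : coords d φ f ∈ Submodule.span F⸨X⸩ (coords d φ '' P)) : f ∈ P := by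
  let π := Q.projection P h.symm
  have hle : Submodule.span F⸨X⸩ (coords d φ '' P) ≤ LinearMap.ker (extend d φ π) := by
    rw [Submodule.span_le]
    rintro _ ⟨g, hg, rfl⟩
    change extend d φ π (coords d φ g) = 0
    rw [extend_coords, (Submodule.projection_apply_eq_zero_iff h.symm).2 hg, map_zero]
  have h0 : extend d φ π (coords d φ f) = 0 := hle hf
  rw [extend_coords] at h0
  exact (Submodule.projection_apply_eq_zero_iff h.symm).1
    (coords_injective d φ (h0.trans (map_zero _).symm))

/-- The polynomials in a subspace of `Fⁿ((X))`, as an `F[X]`-submodule. -/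
def polynomialPart (D : Submodule F⸨X⸩ (HahnModule ℤ F (Fin n → F))) :
    Submodule F[X] (SkewPolynomialRing d) where
  carrier := {f | coords d φ f ∈ D}
  zero_mem' := by simp
  add_mem' hf hg := by
    change coords d φ _ ∈ D
    rw [map_add]
    exact add_mem hf hg
  smul_mem' p f hf := by
    change coords d φ _ ∈ D
    rw [coords_smul]
    exact D.smul_mem _ hf

/-- The polynomials in a subspace of `Fⁿ((X))` form a saturated submodule, since nonzero polynomials
are invertible in `F((X))`. -/
theorem exists_isCompl_polynomialPart [FiniteDimensional F A]
    (D : Submodule F⸨X⸩ (HahnModule ℤ F (Fin n → F))) :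
    ∃ Q, IsCompl (polynomialPart d φ D) Q := by
  refine Submodule.exists_isCompl_of_saturated _ fun p f hp hf => ?_
  have hf' : coords d φ (p • f) ∈ D := hf
  rw [coords_smul] at hf'
  exact (D.smul_mem_iff
    ((map_ne_zero_iff _ (FaithfulSMul.algebraMap_injective F[X] F⸨X⸩)).2 hp)).1 hf'

end SkewPolynomialRing

/-! ### Convolutional codes and their polynomials -/

open SkewPolynomialRing in
/-- A convolutional code is spanned by its polynomials, hence determined by them. -/
theorem IsConvolutionalCode.le_of_polynomialPart_le {F A : Type*} [Field F] [Ring A] [Algebra F A]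
    (d : NilSkewDerivation F A) {n : ℕ} (φ : A ≃ₗ[F] (Fin n → F))
    {D D' : Submodule F⸨X⸩ (HahnModule ℤ F (Fin n → F))} (hD : IsConvolutionalCode D)
    (h : polynomialPart d φ D ≤ polynomialPart d φ D') : D ≤ D' := by
  obtain ⟨k, b, hb⟩ := hD
  have hmem (i : Fin k) : (b i : HahnModule ℤ F (Fin n → F)) ∈ D' := by
    obtain ⟨p, hp⟩ := hb i
    obtain ⟨f, hf⟩ := exists_coords_eq_polyToLaurent d φ p
    rw [hp, ← hf]
    refine h (show coords d φ f ∈ D from ?_)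
    rw [hf, ← hp]
    exact (b i).2
  intro w hw
  have hw' := congrArg D.subtype (b.sum_repr ⟨w, hw⟩)
  rw [map_sum] at hw'
  change _ = w at hw'
  rw [← hw']
  exact sum_mem fun i _ => D'.smul_mem _ (hmem i)

/-- The `F((X))`-span of a set of polynomial vectors is a convolutional code: the span has a basis
among the given vectors. -/
theorem isConvolutionalCode_span {F : Type*} [Field F] {n : ℕ}
    {S : Set (HahnModule ℤ F (Fin n → F))} (hS : ∀ w ∈ S, ∃ p, w = polyToLaurent p) :
    IsConvolutionalCode (Submodule.span F⸨X⸩ S) := by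
  obtain ⟨b, hbS, hspan, hli⟩ := exists_linearIndependent F⸨X⸩ S
  have : Finite b := hli.finite
  let e := Finite.equivFin b
  let B := (Module.Basis.span hli).reindex e
  have hrange : Submodule.span F⸨X⸩ (Set.range ((↑) : b → _)) = Submodule.span F⸨X⸩ S := by
    rw [Subtype.range_coe, hspan]
  rw [← hrange]
  refine ⟨_, B, fun i => ?_⟩
  rw [Module.Basis.reindex_apply, Module.Basis.span_apply]
  exact hS _ (hbS (e.symm i).2)

open SkewPolynomialRing SkewLaurentSeries in
/-- `D ↦ D ∩ A[X; σ, δ]` is a bijection from the `(σ, δ, A)`-cyclic convolutional codes in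
`A((X; σ, δ))` to the right ideal codes, where `Fⁿ` is the right `A`-module isomorphic to the
regular module `A` through an `F`-linear isomorphism `φ`. -/
theorem mainTheorem6 {F A : Type*} [Field F] [Ring A] [Algebra F A] [FiniteDimensional F A]
    (d : NilSkewDerivation F A) {n : ℕ} [Module Aᵐᵒᵖ (Fin n → F)] (φ : A ≃ₗ[F] (Fin n → F))
    (hφ : ∀ a b : A, φ (a * b) = MulOpposite.op b • φ a) :
    Set.BijOn (fun D : Set (SkewLaurentSeries d) =>
        {f : SkewPolynomialRing d | SkewPolynomialRing.toLaurent d f ∈ D})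
      (cyclicCodesInLaurent d φ) (rightIdealCodes d) := by
  refine ⟨?_, ?_, ?_⟩
  · rintro _ ⟨D, ⟨-, hD⟩, rfl⟩
    refine ⟨⟨{ polynomialPart d φ D with smul_mem' := ?_ }, rfl⟩, polynomialPart d φ D, ?_⟩
    · intro g f hf
      have hf' : SkewPolynomialRing.coords d φ f ∈ D := hf
      change SkewLaurentSeries.coords d φ (toLaurent d (f * g.unop)) ∈ D
      rw [map_mul, coords_mul d φ hφ, op_smul_eq_sum d φ hφ]
      exact sum_mem fun j _ => D.smul_mem _ (hD _ _ hf')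
    · obtain ⟨Q, hQ⟩ := exists_isCompl_polynomialPart d φ D
      exact ⟨Q, rfl, hQ⟩
  · rintro _ ⟨D, ⟨hD, -⟩, rfl⟩ _ ⟨D', ⟨hD', -⟩, rfl⟩ h
    have h' : polynomialPart d φ D = polynomialPart d φ D' := SetLike.coe_injective h
    rw [le_antisymm (hD.le_of_polynomialPart_le d φ h'.le)
      (hD'.le_of_polynomialPart_le d φ h'.ge)]
  · rintro _ ⟨⟨J, rfl⟩, P, Q, hP, hPQ⟩
    let D := Submodule.span F⸨X⸩ (SkewPolynomialRing.coords d φ '' P)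
    refine ⟨_, ⟨D, ⟨isConvolutionalCode_span ?_, ?_⟩, rfl⟩, ?_⟩
    · rintro _ ⟨f, -, rfl⟩
      exact ⟨_, coords_eq_polyToLaurent d φ f⟩
    · intro a s hs
      -- Closure under the whole skew Laurent series ring is what passes through scalars `c` in
      -- `F((X))`: `(c • w) t = w (c t)`, while `c a` need not be a multiple of `c` for `a` in `A`.
      suffices h : ∀ t : SkewLaurentSeries d, op t • s ∈ D from h _
      induction hs using Submodule.span_induction with
      | zero => simp
      | add v w _ _ hv hw => exact fun t => by rw [smul_add]; exact add_mem (hv t) (hw t)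
      | smul c w _ hw =>
        intro t
        obtain ⟨s, rfl⟩ := coords_surjective d φ w
        rw [← coords_mul_ofField, coords_mul d φ hφ, smul_smul, ← op_mul]
        exact hw _
      | mem w hw =>
        obtain ⟨f, hf, rfl⟩ := hw
        intro t
        rw [op_smul_eq_sum d φ hφ]
        refine sum_mem fun j _ => D.smul_mem _ (Submodule.subset_span ?_)
        refine ⟨f * SkewPolynomialRing.monomial d 0 (φ.symm (Pi.single j 1)), ?_, ?_⟩
        · rw [hP] at hf ⊢
          exact J.smul_mem (op _) hf
        · change SkewLaurentSeries.coords d φ (toLaurent d (f * _)) = _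
          rw [map_mul, coords_mul d φ hφ, toLaurent_monomial_zero]
          rfl
    · rw [← hP]
      refine Set.Subset.antisymm (fun f hf => mem_of_coords_mem_span d φ hPQ hf)
        fun f hf => Submodule.subset_span ⟨f, hf, rfl⟩
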